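/- Let $d\in\mathbb N$ and let $Z=(Z_1,\dots,Z_d)$ be a random vector with $Z_i\ge 0$ almost surely and $E(Z_i)=1$ for $1\le i\le d$ (the $Z_i$ need not be bounded). Then $Z$ generates a $D$-norm, that is, $$\|x\|_D:=E\Big(\max_{1\le i\le d}|x_i|Z_i\Big)=E\big(\|xZ\|_\infty\big),\qquad x\in\mathbb R^d,$$ where $xZ=(x_1Z_1,\dots,x_dZ_d)$, is finite and is a norm on $\mathbb R^d$; it is a $D$-norm; and $$G(x)=\exp\big(-E(\|xZ\|_\infty)\big)=\exp(-\|x\|_D),\qquad x\le 0\in\mathbb R^d,$$ is a standard max-stable distribution function. Here a $D$-norm is a function on $\mathbb R^d$ of the form $x\mapsto E(\max_{1\le i\le d}|x_i|\tilde Z_i)$ for some random vector $\tilde Z$ with $\tilde Z_i\ge 0$ a.s., $E(\tilde Z_i)=1$ and $\tilde Z_i\le c$ a.s. for $1\le i\le d$ and some constant $c\ge 1$. A random vector $\eta=(\eta_1,\dots,\eta_d)$ is standard max-stable if $P(\eta_i\le t)=e^t$ for all $t\le 0$ and $1\le i\le d$, and if for every integer $n\ge 1$ and every $x\le 0$ in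 $\mathbb R^d$ $$P\Big(n\max_{1\le k\le n}\eta^{(k)}\le x\Big)=P\Big(\eta\le \frac xn\Big)^n=P(\eta\le x),$$ where $\eta^{(1)},\dots,\eta^{(n)}$ are independent copies of $\eta$, and $\max$ and $\le$ are meant componentwise. That $G$ is a standard max-stable distribution function means that there is a standard max-stable random vector $\eta$ with $P(\eta\le x)=G(x)$ for all $x\le 0$. -/

import Mathlib

open MeasureTheory

namespace MaxStable

/-- `N x = E (max_i (|x i| * Z i))` for all `x`, with a finite expectation. No boundedness of `Z` is
required here. -/
def Generates {d : ℕ} {Ω : Type*} [MeasurableSpace Ω] (P : Measure Ω) (Z : Ω → Fin d → ℝ)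
    (N : (Fin d → ℝ) → ℝ) : Prop :=
  ∀ x : Fin d → ℝ,
    Integrable (fun ω => ⨆ i, |x i| * Z ω i) P ∧ N x = ∫ ω, ⨆ i, |x i| * Z ω i ∂P

/-- The defining conditions of a generator in the original, bounded sense. -/
structure IsBoundedGenerator {d : ℕ} {Ω : Type*} [MeasurableSpace Ω] (P : Measure Ω)
    (Z : Ω → Fin d → ℝ) : Prop where
  aemeasurable : AEMeasurable Z P
  nonneg : ∀ i, ∀ᵐ ω ∂P, 0 ≤ Z ω i
  integrable : ∀ i, Integrable (fun ω => Z ω i) P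
  mean_one : ∀ i, ∫ ω, Z ω i ∂P = 1
  bounded : ∃ c : ℝ, 1 ≤ c ∧ ∀ i, ∀ᵐ ω ∂P, Z ω i ≤ c

/-- `N` is a `D`-norm on `ℝ^d`: it arises from some bounded generator. -/
def IsDNorm {d : ℕ} (N : (Fin d → ℝ) → ℝ) : Prop :=
  ∃ (Ω : Type) (_ : MeasurableSpace Ω) (P : Measure Ω) (Z : Ω → Fin d → ℝ),
    IsProbabilityMeasure P ∧ IsBoundedGenerator P Z ∧ Generates P Z N

/-- `η` is a standard max-stable random vector. The `n` independent copies of `η` are realised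
on the `n`-fold product of the law of `η`. -/
structure IsSMS {d : ℕ} {Ω : Type*} [MeasurableSpace Ω] (P : Measure Ω)
    (η : Ω → Fin d → ℝ) : Prop where
  aemeasurable : AEMeasurable η P
  margins : ∀ i, ∀ t : ℝ, t ≤ 0 → P.real {ω | η ω i ≤ t} = Real.exp t
  copies : ∀ n : ℕ, 0 < n → ∀ x : Fin d → ℝ, x ≤ 0 →
    (Measure.pi (fun _ : Fin n => P.map η)).real
      {y : Fin n → Fin d → ℝ | ∀ i, (n : ℝ) * (⨆ k, y k i) ≤ x i} = P.real {ω | η ω ≤ x}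
  power : ∀ n : ℕ, 0 < n → ∀ x : Fin d → ℝ, x ≤ 0 →
    P.real {ω | ∀ i, η ω i ≤ x i / n} ^ n = P.real {ω | η ω ≤ x}

/-- `F` is the distribution function of a standard max-stable random vector. -/
def IsSMSDF {d : ℕ} (F : (Fin d → ℝ) → ℝ) : Prop :=
  ∃ (Ω : Type) (_ : MeasurableSpace Ω) (P : Measure Ω) (η : Ω → Fin d → ℝ),
    IsProbabilityMeasure P ∧ IsSMS P η ∧ ∀ x : Fin d → ℝ, F x = P.real {ω | η ω ≤ x}

end MaxStable

/-!
Write `μ` for the law of `Z` on `ℝ^d`. All quantities in the theorem depend on `Z` only through `μ`,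
and for almost every `z ≥ 0` the number `max_i |x i| * z i` is the sup norm `‖x * z‖`.

**The norm.** `x ↦ ∫ ‖x * z‖ ∂μ` is a seminorm because it averages seminorms (`dSeminorm`). As
`|x i| * z i ≤ ‖x * z‖` and each coordinate has mean one, it dominates every `|x i|`
(`abs_le_dSeminorm`), so it is a norm.

**A bounded generator.** Let `m(z)` be the mean of the coordinates of `z`. Under the measure with
density `m` with respect to `μ`, the vector `m(z)⁻¹ • z` has coordinates in `[0, d]`, and every
positively homogeneous function `f` satisfies `m(z) * f (m(z)⁻¹ • z) = f z`; hence its expectation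
is the same as before the change of measure (`tilt_homogeneous`). Applying this to the coordinates
and to `‖x * ·‖` gives a bounded generator of the same function (`isDNorm_dSeminorm`).

**The max-stable vector.** Consider a Poisson process of points `(u, z)` on `(0, ∞) × ℝ^d` with
intensity Lebesgue measure times `μ`, and let `T i` be the infimum of `u / z i` over its points. For
`x ≤ 0`, the event `-x ≤ T` says that no point lies in `{u < ‖x * z‖}`, a set of intensity
`∫ ‖x * z‖ ∂μ`, so that it has probability `exp (-∫ ‖x * z‖ ∂μ)`. The vector `η = -T` therefore has
the required distribution function. The process is built from independent samples, one for each
strip `k < u ≤ k + 1`, of a Poisson number of independent points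
(`infinitePi_poissonSample_pi_voidSet`). Max-stability of `η` is the homogeneity of the norm, and
its margins are the values of the norm on the coordinate axes (`isSMS_of_real_eq_exp`).
-/

open ProbabilityTheory ENNReal

namespace MaxStable

/-! ### Void probabilities of Poisson samples -/

section PoissonProcess

/-- The event that a finite sample `q` (the first `q.1` terms of `q.2`) has no point in `C`. -/
def voidSet {E : Type*} (C : Set E) : Set (ℕ × (ℕ → E)) := {q | ∀ j < q.1, q.2 j ∉ C}

lemma prodMk_preimage_voidSet {E : Type*} (C : Set E) (n : ℕ) :
    Prod.mk n ⁻¹' voidSet C = Set.pi (Finset.range n) (fun _ => Cᶜ) := by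
  ext w; simp [voidSet]

variable {E : Type*} [MeasurableSpace E]

/-- The law of a finite Poisson sample with intensity the probability measure `ν`: a Poisson number
`q.1` with mean one, and an independent sequence `q.2` of independent points with law `ν`. Only the
first `q.1` points belong to the sample. -/
noncomputable def poissonSample (ν : Measure E) [IsProbabilityMeasure ν] :
    Measure (ℕ × (ℕ → E)) :=
  (poissonMeasure 1).prod (Measure.infinitePi fun _ => ν)

instance (ν : Measure E) [IsProbabilityMeasure ν] : IsProbabilityMeasure (poissonSample ν) := by
  unfold poissonSample; infer_instance

lemma measurableSet_voidSet {C : Set E} (hC : MeasurableSet C) : MeasurableSet (voidSet C) := by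
  have : voidSet C = ⋃ n : ℕ, {n} ×ˢ (Set.pi (Finset.range n : Set ℕ) fun _ => Cᶜ) := by
    ext ⟨n, w⟩; simp [voidSet]
  rw [this]
  exact .iUnion fun n => (measurableSet_singleton n).prod
    (.pi (Finset.countable_toSet _) fun _ _ => hC.compl)

/-- Conditionally on `n` points, all of them avoid `C` with probability `(1 - ν C) ^ n`; summing over
the Poisson weights gives the exponential series at `1 - ν C`. -/
lemma poissonSample_voidSet (ν : Measure E) [IsProbabilityMeasure ν] {C : Set E}
    (hC : MeasurableSet C) :
    poissonSample ν (voidSet C) = .ofReal (Real.exp (-ν.real C)) := by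
  have hp : ν Cᶜ = .ofReal (1 - ν.real C) := by
    rw [← probReal_compl_eq_one_sub hC, ofReal_measureReal]
  have h0 : 0 ≤ 1 - ν.real C := sub_nonneg.2 measureReal_le_one
  rw [poissonSample, Measure.prod_apply (measurableSet_voidSet hC), poissonMeasure,
    lintegral_sum_measure]
  simp_rw [lintegral_smul_measure, lintegral_dirac, prodMk_preimage_voidSet]
  have h (n : ℕ) : Measure.infinitePi (fun _ : ℕ => ν) (Set.pi (Finset.range n) fun _ => Cᶜ) =
      .ofReal ((1 - ν.real C) ^ n) := by
    rw [Measure.infinitePi_pi _ (fun _ _ => hC.compl), Finset.prod_const, Finset.card_range, hp,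
      ofReal_pow h0]
  have hs : HasSum (fun n : ℕ => Real.exp (-1) * ((1 - ν.real C) ^ n / n.factorial))
      (Real.exp (-ν.real C)) := by
    convert! (NormedSpace.expSeries_div_hasSum_exp (1 - ν.real C)).mul_left (Real.exp (-1)) using 1
    rw [← Real.exp_eq_exp_ℝ, ← Real.exp_add]; congr 1; ring
  rw [← hs.tsum_eq, ofReal_tsum_of_nonneg (fun n => by positivity) hs.summable]
  refine tsum_congr fun n => ?_
  rw [h, smul_eq_mul, ← ofReal_mul (by positivity)]
  congr 1
  simp; ring

/-- The superposition of independent Poisson samples of intensities `ν k` is a Poisson process of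
intensity `∑ ν k`: it has no point in `C` with probability `exp (-∑ ν k C)`. -/
lemma infinitePi_poissonSample_pi_voidSet (ν : ℕ → Measure E) [∀ k, IsProbabilityMeasure (ν k)]
    {C : Set E} (hC : MeasurableSet C) (hfin : Measure.sum ν C ≠ ∞) :
    Measure.infinitePi (fun k => poissonSample (ν k)) (Set.univ.pi fun _ => voidSet C) =
      .ofReal (Real.exp (-(Measure.sum ν).real C)) := by
  rw [Measure.sum_apply _ hC] at hfin
  rw [Measure.infinitePi_pi_univ _ fun _ => measurableSet_voidSet hC]
  simp_rw [poissonSample_voidSet _ hC]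
  have hs : HasSum (fun k => (ν k).real C) ((Measure.sum ν).real C) := by
    rw [measureReal_def, Measure.sum_apply _ hC]
    rw [ENNReal.tsum_toReal_eq fun k => measure_ne_top _ _]
    exact ENNReal.hasSum_toReal hfin
  have hp := hs.neg.rexp
  refine HasProd.tprod_eq ?_
  have h2 := (continuous_ofReal.tendsto _).comp hp
  refine h2.congr fun s => ?_
  simp [ofReal_prod_of_nonneg, Real.exp_nonneg]

end PoissonProcess

/-! ### Componentwise infimum of the Poisson points -/

section Minimum

variable {d : ℕ}

/-- The componentwise infimum of all points of a sequence of finite samples in `[0, ∞]^d`, equal to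
`∞` if there is no point. -/
noncomputable def sampleMin (w : ℕ → ℕ × (ℕ → Fin d → ℝ≥0∞)) : Fin d → ℝ≥0∞ :=
  ⨅ k, ⨅ j, if j < (w k).1 then (w k).2 j else ⊤

lemma le_sampleMin_iff {y : Fin d → ℝ≥0∞} {w : ℕ → ℕ × (ℕ → Fin d → ℝ≥0∞)} :
    y ≤ sampleMin w ↔ ∀ k, w k ∈ voidSet (Set.Ici y)ᶜ := by
  simp only [sampleMin, le_iInf_iff, voidSet, Set.mem_ofPred_eq, Set.mem_compl_iff, Set.mem_Ici,
    not_not]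
  refine forall_congr' fun k => forall_congr' fun j => ?_
  split_ifs with h <;> simp [h]

lemma measurable_sampleMin : Measurable (sampleMin (d := d)) := by
  refine measurable_pi_lambda _ fun i => ?_
  have : (fun w => sampleMin (d := d) w i) =
      fun w => ⨅ k, ⨅ j, if j < (w k).1 then (w k).2 j i else ⊤ := by
    ext w
    simp only [sampleMin, iInf_apply]
    refine iInf_congr fun k => iInf_congr fun j => ?_
    split_ifs <;> rfl
  rw [this]
  refine .iInf fun k => .iInf fun j => .ite ?_ (by fun_prop) measurable_const
  exact measurableSet_lt measurable_const (by fun_prop)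

lemma infinitePi_poissonSample_le_sampleMin (ν : ℕ → Measure (Fin d → ℝ≥0∞))
    [∀ k, IsProbabilityMeasure (ν k)] (y : Fin d → ℝ≥0∞)
    (hfin : Measure.sum ν (Set.Ici y)ᶜ ≠ ∞) :
    Measure.infinitePi (fun k => poissonSample (ν k)) {w | y ≤ sampleMin w} =
      .ofReal (Real.exp (-(Measure.sum ν).real (Set.Ici y)ᶜ)) := by
  rw [← infinitePi_poissonSample_pi_voidSet ν measurableSet_Ici.compl hfin]
  congr 1
  ext w
  simp [le_sampleMin_iff]

end Minimum

/-! ### The intensity of the points `u / z` -/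

section Intensity

variable {d : ℕ}

/-- The point `u / z` of `[0, ∞]^d`, for `p = (u, z)`. For `u > 0`, a coordinate with `z i = 0` gives
`∞`. -/
noncomputable def scaledPoint (p : ℝ × (Fin d → ℝ)) : Fin d → ℝ≥0∞ :=
  fun i => .ofReal p.1 / .ofReal (p.2 i)

lemma measurable_scaledPoint : Measurable (scaledPoint (d := d)) := by
  unfold scaledPoint; fun_prop

lemma iUnion_Ioc_natCast_add_one : ⋃ k : ℕ, Set.Ioc (k : ℝ) (k + 1) = Set.Ioi 0 := by
  ext u
  simp only [Set.mem_iUnion, Set.mem_Ioc, Set.mem_Ioi]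
  refine ⟨fun ⟨k, hk, _⟩ => k.cast_nonneg.trans_lt hk, fun hu => ⟨⌈u⌉₊ - 1, ?_⟩⟩
  have h1 : 1 ≤ ⌈u⌉₊ := Nat.one_le_ceil_iff.2 hu
  push_cast [h1]
  constructor
  · linarith [Nat.ceil_lt_add_one hu.le]
  · linarith [Nat.le_ceil u]

lemma sum_restrict_Ioc_prod (μ : Measure (Fin d → ℝ)) [SFinite μ] :
    Measure.sum (fun k : ℕ => (volume.restrict (Set.Ioc (k : ℝ) (k + 1))).prod μ) =
      (volume.restrict (Set.Ioi (0 : ℝ))).prod μ := by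
  rw [← Measure.prod_sum_left, ← iUnion_Ioc_natCast_add_one, Measure.restrict_iUnion _
    fun _ => measurableSet_Ioc]
  intro i j hij
  refine Set.disjoint_left.2 fun u hi hj => hij ?_
  simp only [Set.mem_Ioc] at hi hj
  have h1 : i < j + 1 := by exact_mod_cast hi.1.trans_le hj.2
  have h2 : j < i + 1 := by exact_mod_cast hj.1.trans_le hi.2
  omega

lemma ofReal_div_ofReal_lt_iff {u z t : ℝ} (hu : 0 < u) (hz : 0 ≤ z) :
    ENNReal.ofReal u / .ofReal z < .ofReal t ↔ u < t * z := by
  rw [ENNReal.div_lt_iff (.inr (by simpa using hu)) (.inr ofReal_ne_top), ← ofReal_mul' hz,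
    ofReal_lt_ofReal_iff_of_nonneg hu.le]

lemma lt_norm_mul_iff {x z : Fin d → ℝ} (hx : x ≤ 0) (hz : 0 ≤ z) {u : ℝ} (hu : 0 < u) :
    u < ‖x * z‖ ↔ ∃ i, u < -x i * z i := by
  rw [← not_le, pi_norm_le_iff_of_nonneg hu.le]
  push Not
  refine exists_congr fun i => ?_
  rw [Pi.mul_apply, norm_mul, Real.norm_of_nonpos (hx i), Real.norm_of_nonneg (hz i)]

/-- Integrating over `u` first, the pairs `(u, z)` with `u > 0` and `-x ≰ u / z` are those with
`0 < u < ‖x * z‖`. -/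
lemma intensity_compl_Ici (μ : Measure (Fin d → ℝ)) [SFinite μ] (hμ : ∀ᵐ z ∂μ, 0 ≤ z)
    {x : Fin d → ℝ} (hx : x ≤ 0) :
    ((volume.restrict (Set.Ioi (0 : ℝ))).prod μ).map scaledPoint
      (Set.Ici fun i => ENNReal.ofReal (-x i))ᶜ = ∫⁻ z, ‖x * z‖ₑ ∂μ := by
  have hm := measurable_scaledPoint (d := d)
    (measurableSet_Ici (a := fun i => ENNReal.ofReal (-x i))).compl
  rw [Measure.map_apply measurable_scaledPoint measurableSet_Ici.compl,
    Measure.prod_apply_symm hm]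
  refine lintegral_congr_ae (hμ.mono fun z hz => ?_)
  dsimp only
  rw [Measure.restrict_apply (measurable_prodMk_right hm), ← ofReal_norm]
  have : (fun u => (u, z)) ⁻¹' (scaledPoint ⁻¹' (Set.Ici fun i => ENNReal.ofReal (-x i))ᶜ) ∩
      Set.Ioi 0 = Set.Ioo 0 ‖x * z‖ := by
    ext u
    simp only [Set.mem_inter_iff, Set.mem_preimage, Set.mem_compl_iff, Set.mem_Ici, Set.mem_Ioi,
      Set.mem_Ioo, Pi.le_def, not_forall, not_le, scaledPoint]
    rw [and_comm]
    refine and_congr_right fun hu => ?_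
    rw [lt_norm_mul_iff hx hz hu]
    exact exists_congr fun i => ofReal_div_ofReal_lt_iff hu (hz i)
  rw [this, Real.volume_Ioo, sub_zero]

end Intensity

/-! ### Existence of the max-stable random vector -/

section Existence

variable {d : ℕ}

lemma integrable_norm_mul {μ : Measure (Fin d → ℝ)} (hint : Integrable id μ) (x : Fin d → ℝ) :
    Integrable (fun z => ‖x * z‖) μ := by
  refine Integrable.norm (Integrable.of_eval fun i => ?_)
  exact (hint.eval i).const_mul (x i)

/-- There is a random vector in `[0, ∞]^d` with survival function `-x ↦ exp (-∫ ‖x * z‖ ∂μ)`. -/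
lemma exists_arrival (μ : Measure (Fin d → ℝ)) [IsProbabilityMeasure μ]
    (hμ : ∀ᵐ z ∂μ, 0 ≤ z) (hint : Integrable id μ) :
    ∃ (Ω : Type) (_ : MeasurableSpace Ω) (Q : Measure Ω) (T : Ω → Fin d → ℝ≥0∞),
      IsProbabilityMeasure Q ∧ Measurable T ∧ ∀ x : Fin d → ℝ, x ≤ 0 →
        Q.real {ω | (fun i => ENNReal.ofReal (-x i)) ≤ T ω} = Real.exp (-∫ z, ‖x * z‖ ∂μ) := by
  have hprob (k : ℕ) : IsProbabilityMeasure (volume.restrict (Set.Ioc (k : ℝ) (k + 1))) :=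
    ⟨by simp⟩
  let ν (k : ℕ) : Measure (Fin d → ℝ≥0∞) :=
    ((volume.restrict (Set.Ioc (k : ℝ) (k + 1))).prod μ).map scaledPoint
  have hν (k : ℕ) : IsProbabilityMeasure (ν k) :=
    Measure.isProbabilityMeasure_map measurable_scaledPoint.aemeasurable
  have hsum : Measure.sum ν = ((volume.restrict (Set.Ioi (0 : ℝ))).prod μ).map scaledPoint := by
    rw [← sum_restrict_Ioc_prod, Measure.map_sum measurable_scaledPoint.aemeasurable]
  refine ⟨_, _, Measure.infinitePi fun k => poissonSample (ν k), sampleMin, inferInstance,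
    measurable_sampleMin, fun x hx => ?_⟩
  have hx' := integrable_norm_mul hint x
  have hmass : Measure.sum ν (Set.Ici fun i => ENNReal.ofReal (-x i))ᶜ =
      .ofReal (∫ z, ‖x * z‖ ∂μ) := by
    rw [hsum, intensity_compl_Ici μ hμ hx,
      ofReal_integral_eq_lintegral_ofReal hx' (.of_forall fun _ => norm_nonneg _)]
    simp
  rw [measureReal_def, infinitePi_poissonSample_le_sampleMin ν _ (by simp [hmass]),
    measureReal_def, hmass, toReal_ofReal (integral_nonneg fun _ => norm_nonneg _),
    toReal_ofReal (Real.exp_nonneg _)]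

lemma norm_single_mul (i : Fin d) (t : ℝ) (z : Fin d → ℝ) :
    ‖Pi.single i t * z‖ = |t| * |z i| := by
  have : Pi.single i t * z = Pi.single i (t * z i) := by
    ext j; rcases eq_or_ne j i with rfl | h <;> simp [*]
  rw [this, Pi.norm_single, Real.norm_eq_abs, abs_mul]

lemma integral_norm_single_mul {μ : Measure (Fin d → ℝ)} (hμ : ∀ᵐ z ∂μ, 0 ≤ z)
    (hmean : ∀ i, ∫ z, z i ∂μ = 1) (i : Fin d) (t : ℝ) :
    ∫ z, ‖Pi.single i t * z‖ ∂μ = |t| := by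
  simp_rw [norm_single_mul]
  rw [integral_const_mul, integral_congr_ae (hμ.mono fun z hz => abs_of_nonneg (hz i)), hmean,
    mul_one]

/-- Since `P (T i ≥ n) = exp (-n)`, no coordinate is infinite. -/
lemma ae_ne_top_of_arrival {μ : Measure (Fin d → ℝ)} (hμ : ∀ᵐ z ∂μ, 0 ≤ z)
    (hmean : ∀ i, ∫ z, z i ∂μ = 1) {Ω : Type*} [MeasurableSpace Ω] {Q : Measure Ω}
    [IsProbabilityMeasure Q] {T : Ω → Fin d → ℝ≥0∞}
    (hT : ∀ x : Fin d → ℝ, x ≤ 0 →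
        Q.real {ω | (fun i => ENNReal.ofReal (-x i)) ≤ T ω} = Real.exp (-∫ z, ‖x * z‖ ∂μ)) :
    ∀ᵐ ω ∂Q, ∀ i, T ω i ≠ ∞ := by
  refine ae_all_iff.2 fun i => ?_
  rw [ae_iff, ← measureReal_eq_zero_iff]
  refine le_antisymm ?_ measureReal_nonneg
  refine ge_of_tendsto (x := Filter.atTop) (f := fun n : ℕ => Real.exp (-(n : ℝ)))
    (Real.tendsto_exp_neg_atTop_nhds_zero.comp tendsto_natCast_atTop_atTop)
    (.of_forall fun n => ?_)
  have hle : Pi.single i (-(n : ℝ)) ≤ (0 : Fin d → ℝ) := by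
    rw [← Pi.single_zero i]; exact Pi.single_mono _ (by simp)
  have h := hT _ hle
  rw [integral_norm_single_mul hμ hmean, abs_neg, Nat.abs_cast] at h
  rw [← h]
  refine measureReal_mono fun ω hω j => ?_
  rcases eq_or_ne j i with rfl | hj
  · simp_all
  · simp [hj]

lemma exists_randomVector (μ : Measure (Fin d → ℝ)) [IsProbabilityMeasure μ]
    (hμ : ∀ᵐ z ∂μ, 0 ≤ z) (hint : Integrable id μ) (hmean : ∀ i, ∫ z, z i ∂μ = 1) :
    ∃ (Ω : Type) (_ : MeasurableSpace Ω) (Q : Measure Ω) (η : Ω → Fin d → ℝ),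
      IsProbabilityMeasure Q ∧ Measurable η ∧ (∀ ω, η ω ≤ 0) ∧ ∀ x : Fin d → ℝ, x ≤ 0 →
        Q.real {ω | η ω ≤ x} = Real.exp (-∫ z, ‖x * z‖ ∂μ) := by
  obtain ⟨Ω, _, Q, T, _, hTm, hT⟩ := exists_arrival μ hμ hint
  refine ⟨Ω, _, Q, fun ω i => -(T ω i).toReal, inferInstance, by fun_prop,
    fun ω i => by simp, fun x hx => ?_⟩
  rw [← hT x hx]
  refine measureReal_congr ((ae_ne_top_of_arrival hμ hmean hT).mono fun ω hω => ?_)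
  refine propext (forall_congr' fun i => ?_)
  rw [ENNReal.ofReal_le_iff_le_toReal (hω i), neg_le]

/-- A nonpositive random vector with distribution function `exp (-∫ ‖x * z‖ ∂μ)` on `x ≤ 0` is
standard max-stable. -/
lemma isSMS_of_real_eq_exp {μ : Measure (Fin d → ℝ)} (hμ : ∀ᵐ z ∂μ, 0 ≤ z)
    (hmean : ∀ i, ∫ z, z i ∂μ = 1) {Ω : Type*} [MeasurableSpace Ω] {Q : Measure Ω}
    [IsProbabilityMeasure Q] {η : Ω → Fin d → ℝ} (hη : Measurable η) (hη0 : ∀ ω, η ω ≤ 0)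
    (hdf : ∀ x : Fin d → ℝ, x ≤ 0 →
        Q.real {ω | η ω ≤ x} = Real.exp (-∫ z, ‖x * z‖ ∂μ)) :
    IsSMS Q η := by
  have power (n : ℕ) (hn : 0 < n) (x : Fin d → ℝ) (hx : x ≤ 0) :
      Q.real {ω | ∀ i, η ω i ≤ x i / n} ^ n = Q.real {ω | η ω ≤ x} := by
    have hn' : (0 : ℝ) < n := by exact_mod_cast hn
    have h := hdf (fun i => x i / n) fun i => div_nonpos_of_nonpos_of_nonneg (hx i) hn'.le
    have h' (z : Fin d → ℝ) : ‖(fun i => x i / n) * z‖ = (n : ℝ)⁻¹ * ‖x * z‖ := by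
      rw [← Real.norm_of_nonneg (inv_nonneg.2 hn'.le), ← norm_smul]
      congr 1; ext i; simp; ring
    simp_rw [h', integral_const_mul] at h
    rw [hdf x hx]
    simp only [Pi.le_def] at h
    rw [h, ← Real.exp_nat_mul]
    congr 1
    field_simp
  refine ⟨hη.aemeasurable, fun i t ht => ?_, fun n hn x hx => ?_, power⟩
  · have hle : Pi.single i t ≤ (0 : Fin d → ℝ) := by
      rw [← Pi.single_zero i]; exact Pi.single_mono _ ht
    have h := hdf _ hle
    rw [integral_norm_single_mul hμ hmean, abs_of_nonpos ht, neg_neg] at h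
    rw [← h]
    -- As `η ≤ 0`, the event `η i ≤ t` is `η ≤ t • e_i`.
    congr 1
    ext ω
    refine ⟨fun hω j => ?_, fun hω => by simpa using hω i⟩
    rcases eq_or_ne j i with rfl | hj
    · simpa using hω
    · simpa [hj] using hη0 ω j
  · have hn' : (0 : ℝ) < n := by exact_mod_cast hn
    have : Nonempty (Fin n) := ⟨⟨0, hn⟩⟩
    have : IsProbabilityMeasure (Q.map η) := Measure.isProbabilityMeasure_map hη.aemeasurable
    have hset : {y : Fin n → Fin d → ℝ | ∀ i, (n : ℝ) * (⨆ k, y k i) ≤ x i} =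
        Set.univ.pi fun _ => Set.Iic fun i => x i / n := by
      ext y
      simp only [Set.mem_ofPred_eq, Set.mem_univ_pi, Set.mem_Iic, Pi.le_def]
      rw [forall_comm]
      refine forall_congr' fun i => ?_
      rw [mul_comm, ← le_div_iff₀ hn', ciSup_le_iff (Set.finite_range _).bddAbove]
    rw [hset, measureReal_def, Measure.pi_pi, Finset.prod_const, Finset.card_univ,
      Fintype.card_fin, toReal_pow, ← measureReal_def,
      map_measureReal_apply hη measurableSet_Iic, ← power n hn x hx]
    rfl

theorem exists_isSMSDF (μ : Measure (Fin d → ℝ)) [IsProbabilityMeasure μ]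
    (hμ : ∀ᵐ z ∂μ, 0 ≤ z) (hint : Integrable id μ) (hmean : ∀ i, ∫ z, z i ∂μ = 1) :
    ∃ F : (Fin d → ℝ) → ℝ, IsSMSDF F ∧
      ∀ x : Fin d → ℝ, x ≤ 0 → F x = Real.exp (-∫ z, ‖x * z‖ ∂μ) := by
  obtain ⟨Ω, _, Q, η, hQ, hη, hη0, hdf⟩ := exists_randomVector μ hμ hint hmean
  exact ⟨fun x => Q.real {ω | η ω ≤ x},
    ⟨Ω, _, Q, η, hQ, isSMS_of_real_eq_exp hμ hmean hη hη0 hdf, fun _ => rfl⟩, hdf⟩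

end Existence

/-! ### The seminorm `x ↦ E ‖x * Z‖` -/

section Norm

variable {d : ℕ}

lemma iSup_abs_mul_eq_norm (x : Fin d → ℝ) {z : Fin d → ℝ} (hz : 0 ≤ z) :
    ⨆ i, |x i| * z i = ‖x * z‖ := by
  have h (i : Fin d) : |x i| * z i = ‖(x * z) i‖ := by
    rw [Pi.mul_apply, norm_mul, Real.norm_eq_abs, Real.norm_of_nonneg (hz i)]
  simp_rw [h]
  refine le_antisymm (Real.iSup_le (fun i => norm_le_pi_norm _ i) (norm_nonneg _)) ?_
  rw [pi_norm_le_iff_of_nonneg (Real.iSup_nonneg fun i => norm_nonneg _)]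
  exact fun i => le_ciSup (f := fun i => ‖(x * z) i‖) (Set.finite_range _).bddAbove i

/-- The seminorm `x ↦ E ‖x * Z‖` of a random vector `Z` with integrable law `μ`. -/
noncomputable def dSeminorm (μ : Measure (Fin d → ℝ)) (hint : Integrable id μ) :
    Seminorm ℝ (Fin d → ℝ) :=
  .of (fun x => ∫ z, ‖x * z‖ ∂μ)
    (fun x y => by
      rw [← integral_add (integrable_norm_mul hint x) (integrable_norm_mul hint y)]
      refine integral_mono (integrable_norm_mul hint _)
        ((integrable_norm_mul hint x).add (integrable_norm_mul hint y)) fun z => ?_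
      simp only [add_mul]
      exact norm_add_le _ _)
    (fun c x => by simp_rw [smul_mul_assoc, norm_smul]; exact integral_const_mul _ _)

lemma dSeminorm_apply (μ : Measure (Fin d → ℝ)) (hint : Integrable id μ) (x : Fin d → ℝ) :
    dSeminorm μ hint x = ∫ z, ‖x * z‖ ∂μ := rfl

lemma abs_le_dSeminorm {μ : Measure (Fin d → ℝ)} (hμ : ∀ᵐ z ∂μ, 0 ≤ z) (hint : Integrable id μ)
    (hmean : ∀ i, ∫ z, z i ∂μ = 1) (x : Fin d → ℝ) (i : Fin d) : |x i| ≤ dSeminorm μ hint x := by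
  rw [← integral_norm_single_mul hμ hmean i (x i), dSeminorm_apply]
  refine integral_mono (integrable_norm_mul hint _) (integrable_norm_mul hint _) fun z => ?_
  rw [norm_single_mul, ← abs_mul]
  exact norm_le_pi_norm (x * z) i

end Norm

/-! ### Change of measure to a bounded generator -/

section Tilt

variable {d : ℕ}

/-- The arithmetic mean of the coordinates of `z`. -/
noncomputable def meanCoord (z : Fin d → ℝ) : ℝ := (∑ i, z i) / d

lemma measurable_meanCoord : Measurable (meanCoord (d := d)) := by
  unfold meanCoord; fun_prop

lemma meanCoord_nonneg {z : Fin d → ℝ} (hz : 0 ≤ z) : 0 ≤ meanCoord z :=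
  div_nonneg (Finset.sum_nonneg fun i _ => hz i) (by positivity)

lemma le_mul_meanCoord {z : Fin d → ℝ} (hz : 0 ≤ z) (i : Fin d) : z i ≤ d * meanCoord z := by
  have : (0 : ℝ) < d := by exact_mod_cast i.pos
  rw [meanCoord, mul_div_cancel₀ _ this.ne']
  exact Finset.single_le_sum (fun j _ => hz j) (Finset.mem_univ i)

/-- The identity persists if the mean vanishes, since then `z = 0`. -/
lemma meanCoord_smul_inv_smul {z : Fin d → ℝ} (hz : 0 ≤ z) :
    meanCoord z • (meanCoord z)⁻¹ • z = z := by
  rcases eq_or_ne (meanCoord z) 0 with h | h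
  · ext i
    have := le_mul_meanCoord hz i
    rw [h, mul_zero] at this
    simpa [h] using (le_antisymm this (hz i)).symm
  · exact smul_inv_smul₀ h z

lemma integrable_meanCoord {μ : Measure (Fin d → ℝ)} (hint : Integrable id μ) :
    Integrable meanCoord μ :=
  (integrable_finsetSum _ fun i _ => hint.eval i).div_const _

lemma integral_meanCoord [NeZero d] {μ : Measure (Fin d → ℝ)} (hint : Integrable id μ)
    (hmean : ∀ i, ∫ z, z i ∂μ = 1) : ∫ z, meanCoord z ∂μ = 1 := by
  unfold meanCoord
  have hi (i : Fin d) : Integrable (fun z : Fin d → ℝ => z i) μ := hint.eval i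
  rw [integral_div, integral_finsetSum _ fun i _ => hi i]
  simp [hmean, NeZero.ne]

/-- The measure with density `meanCoord` with respect to `μ`; the positive part in the density is
immaterial when `μ` is supported on nonnegative vectors. -/
noncomputable def tilt (μ : Measure (Fin d → ℝ)) : Measure (Fin d → ℝ) :=
  μ.withDensity fun z => (meanCoord z).toNNReal

lemma ae_tilt {μ : Measure (Fin d → ℝ)} {p : (Fin d → ℝ) → Prop} (h : ∀ᵐ z ∂μ, p z) :
    ∀ᵐ z ∂tilt μ, p z :=
  (withDensity_absolutelyContinuous _ _).ae_le h

lemma isProbabilityMeasure_tilt [NeZero d] {μ : Measure (Fin d → ℝ)} (hμ : ∀ᵐ z ∂μ, 0 ≤ z)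
    (hint : Integrable id μ) (hmean : ∀ i, ∫ z, z i ∂μ = 1) : IsProbabilityMeasure (tilt μ) := by
  refine ⟨?_⟩
  rw [tilt, withDensity_apply _ .univ, Measure.restrict_univ]
  change ∫⁻ z, ENNReal.ofReal (meanCoord z) ∂μ = 1
  rw [← ofReal_integral_eq_lintegral_ofReal (integrable_meanCoord hint)
    (hμ.mono fun z hz => meanCoord_nonneg hz), integral_meanCoord hint hmean, ofReal_one]

/-- Integrals of positively homogeneous functions are unchanged when `μ` is tilted by `meanCoord`
and the argument is divided by `meanCoord`. -/
lemma tilt_homogeneous {μ : Measure (Fin d → ℝ)} (hμ : ∀ᵐ z ∂μ, 0 ≤ z)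
    {f : (Fin d → ℝ) → ℝ} (hf : ∀ (c : ℝ) z, 0 ≤ c → f (c • z) = c * f z) :
    (Integrable (fun z => f ((meanCoord z)⁻¹ • z)) (tilt μ) ↔ Integrable f μ) ∧
      ∫ z, f ((meanCoord z)⁻¹ • z) ∂tilt μ = ∫ z, f z ∂μ := by
  have hm : Measurable fun z : Fin d → ℝ => (meanCoord z).toNNReal :=
    measurable_meanCoord.real_toNNReal
  have h : (fun z => (meanCoord z).toNNReal • f ((meanCoord z)⁻¹ • z)) =ᵐ[μ] f := by
    filter_upwards [hμ] with z hz
    rw [NNReal.smul_def, Real.coe_toNNReal _ (meanCoord_nonneg hz), smul_eq_mul,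
      ← hf _ _ (meanCoord_nonneg hz), meanCoord_smul_inv_smul hz]
  constructor
  · rw [tilt, integrable_withDensity_iff_integrable_smul hm, integrable_congr h]
  · rw [tilt, integral_withDensity_eq_integral_smul hm, integral_congr_ae h]

theorem isDNorm_dSeminorm (μ : Measure (Fin d → ℝ)) [IsProbabilityMeasure μ]
    (hμ : ∀ᵐ z ∂μ, 0 ≤ z) (hint : Integrable id μ) (hmean : ∀ i, ∫ z, z i ∂μ = 1) :
    IsDNorm (dSeminorm μ hint) := by
  have hd : (∀ᵐ z ∂tilt μ, (0 : Fin d → ℝ) ≤ (meanCoord z)⁻¹ • z) :=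
    ae_tilt (hμ.mono fun z hz => smul_nonneg (inv_nonneg.2 (meanCoord_nonneg hz)) hz)
  -- For `d = 0` the tilted measure vanishes, but `μ` itself is trivially bounded.
  rcases Nat.eq_zero_or_pos d with rfl | hd0
  · refine ⟨_, _, μ, id, inferInstance, ⟨aemeasurable_id, fun i => i.elim0, fun i => i.elim0,
      fun i => i.elim0, 1, le_rfl, fun i => i.elim0⟩, fun x => ?_⟩
    have h (z : Fin 0 → ℝ) : ‖x * z‖ = 0 := by rw [Subsingleton.elim (x * z) 0, norm_zero]
    simp [dSeminorm_apply, h]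
  have : NeZero d := ⟨hd0.ne'⟩
  refine ⟨_, _, tilt μ, fun z => (meanCoord z)⁻¹ • z, isProbabilityMeasure_tilt hμ hint hmean,
    ⟨(measurable_meanCoord.inv.smul measurable_id).aemeasurable, fun i => ?_, fun i => ?_,
      fun i => ?_, d, by exact_mod_cast hd0, fun i => ?_⟩, fun x => ?_⟩
  · exact hd.mono fun z hz => hz i
  · exact (tilt_homogeneous hμ (f := fun z => z i) fun c z _ => rfl).1.2 (hint.eval i)
  · exact (tilt_homogeneous hμ (f := fun z => z i) fun c z _ => rfl).2.trans (hmean i)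
  · refine ae_tilt (hμ.mono fun z hz => ?_)
    rw [Pi.smul_apply, smul_eq_mul]
    exact inv_mul_le_of_le_mul₀ (meanCoord_nonneg hz) (by positivity)
      ((le_mul_meanCoord hz i).trans_eq (mul_comm _ _))
  · have hx : (fun z => ⨆ i, |x i| * ((meanCoord z)⁻¹ • z) i) =ᵐ[tilt μ]
        fun z => ‖x * (meanCoord z)⁻¹ • z‖ := hd.mono fun z hz => iSup_abs_mul_eq_norm x hz
    have hhom := tilt_homogeneous hμ (f := fun z => ‖x * z‖) fun c z hc => by
      rw [mul_smul_comm, norm_smul, Real.norm_of_nonneg hc]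
    exact ⟨(integrable_congr hx).2 (hhom.1.2 (integrable_norm_mul hint x)),
      (hhom.2.symm.trans (integral_congr_ae hx.symm))⟩

end Tilt

end MaxStable

theorem mainTheorem6 {d : ℕ} {Ω : Type*} [MeasurableSpace Ω] (P : Measure Ω)
    [IsProbabilityMeasure P] (Z : Ω → Fin d → ℝ) (hZ : AEMeasurable Z P)
    (hnonneg : ∀ i, ∀ᵐ ω ∂P, 0 ≤ Z ω i)
    (hint : ∀ i, Integrable (fun ω => Z ω i) P)
    (hmean : ∀ i, ∫ ω, Z ω i ∂P = 1) :
    ∃ N : Seminorm ℝ (Fin d → ℝ),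
      (∀ x, N x = 0 → x = 0) ∧
      MaxStable.Generates P Z N ∧
      MaxStable.IsDNorm N ∧
      (∀ x, Integrable (fun ω => ‖x * Z ω‖) P ∧ N x = ∫ ω, ‖x * Z ω‖ ∂P) ∧
      ∃ F : (Fin d → ℝ) → ℝ, MaxStable.IsSMSDF F ∧
        ∀ x : Fin d → ℝ, x ≤ 0 → F x = Real.exp (-∫ ω, ‖x * Z ω‖ ∂P) := by
  have hZ0 : ∀ᵐ ω ∂P, 0 ≤ Z ω := ae_all_iff.2 hnonneg
  have hprob : IsProbabilityMeasure (P.map Z) := Measure.isProbabilityMeasure_map hZ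
  have hμ : ∀ᵐ z ∂P.map Z, 0 ≤ z := (ae_map_iff hZ measurableSet_Ici).2 hZ0
  have hμint : Integrable id (P.map Z) :=
    (integrable_map_measure aestronglyMeasurable_id hZ).2 (Integrable.of_eval hint)
  have hμmean (i : Fin d) : ∫ z, z i ∂P.map Z = 1 := by
    rw [integral_map hZ (measurable_pi_apply i).aestronglyMeasurable, hmean]
  have hm (x : Fin d → ℝ) : Measurable fun z => ‖x * z‖ := by fun_prop
  have hmap (x : Fin d → ℝ) : ∫ z, ‖x * z‖ ∂P.map Z = ∫ ω, ‖x * Z ω‖ ∂P :=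
    integral_map hZ (hm x).aestronglyMeasurable
  have hN (x : Fin d → ℝ) : Integrable (fun ω => ‖x * Z ω‖) P ∧
      MaxStable.dSeminorm (P.map Z) hμint x = ∫ ω, ‖x * Z ω‖ ∂P :=
    ⟨(integrable_map_measure (hm x).aestronglyMeasurable hZ).1
      (MaxStable.integrable_norm_mul hμint x), hmap x⟩
  refine ⟨MaxStable.dSeminorm (P.map Z) hμint, fun x hx => funext fun i => ?_, fun x => ?_,
    MaxStable.isDNorm_dSeminorm _ hμ hμint hμmean, hN, ?_⟩
  · exact abs_nonpos_iff.1 (hx ▸ MaxStable.abs_le_dSeminorm hμ hμint hμmean x i)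
  · have h : (fun ω => ⨆ i, |x i| * Z ω i) =ᵐ[P] fun ω => ‖x * Z ω‖ :=
      hZ0.mono fun ω hω => MaxStable.iSup_abs_mul_eq_norm x hω
    exact ⟨(integrable_congr h).2 (hN x).1, (hN x).2.trans (integral_congr_ae h.symm)⟩
  · simpa only [hmap] using MaxStable.exists_isSMSDF _ hμ hμint hμmean
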